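/- A pure three-qubit state is a unit vector $\psi\in\mathbb{C}^2\otimes\mathbb{C}^2\otimes\mathbb{C}^2$. Put $$G(\psi)=\max\bigl\{|\langle a\otimes b\otimes c,\psi\rangle| : a,b,c\in\mathbb{C}^2,\ \|a\|=\|b\|=\|c\|=1\bigr\},$$ and let $E_G(\psi)=1-G(\psi)^2$ be the geometric measure of entanglement of $\psi$. Call a pure three-qubit state $\psi$ maximally entangled if $E_G(\varphi)\le E_G(\psi)$ for every pure three-qubit state $\varphi$. Let $W=\tfrac{1}{\sqrt3}\bigl(|001\rangle+|010\rangle+|100\rangle\bigr)$, where $|ijk\rangle=e_i\otimes e_j\otimes e_k$ for the standard basis $e_0,e_1$ of $\mathbb{C}^2$. Theorem. The W state is maximally entangled, with $G(W)^2=\tfrac49$, and up to local unitary transformations it is the unique maximally entangled pure three-qubit state: a vector $\psi\in\mathbb{C}^2\otimes\mathbb{C}^2\otimes\mathbb{C}^2$ is a maximally entangled pure three-qubit state if and only if $\psi=(A\otimes B\otimes C)W$ for some unitary $2\times2$ matrices $A,B,C$. -/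

import Mathlib

open scoped Kronecker

noncomputable section

/-- The Hilbert space `ℂ²` of one qubit, with orthonormal basis `|0⟩, |1⟩`. -/
abbrev Qubit : Type := EuclideanSpace ℂ (Fin 2)

/-- The Hilbert space `ℂ² ⊗ ℂ² ⊗ ℂ²` of three qubits; the coordinate at `(i, j, k)` is the
amplitude of the basis vector `|i j k⟩`. -/
abbrev ThreeQubit : Type := EuclideanSpace ℂ (Fin 2 × Fin 2 × Fin 2)

/-- The product vector `|a⟩ ⊗ |b⟩ ⊗ |c⟩`. -/
def productVector (a b c : Qubit) : ThreeQubit :=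
  WithLp.toLp 2 fun p => a p.1 * b p.2.1 * c p.2.2

/-- The set of all overlaps `|⟨a ⊗ b ⊗ c | ψ⟩|` of `ψ` with normalized product states. -/
def overlapSet (ψ : ThreeQubit) : Set ℝ :=
  {r | ∃ a b c : Qubit, ‖a‖ = 1 ∧ ‖b‖ = 1 ∧ ‖c‖ = 1 ∧ r = ‖inner ℂ (productVector a b c) ψ‖}

/-- `G(ψ)`, the maximal overlap of `ψ` with normalized product states. -/
def maxOverlap (ψ : ThreeQubit) : ℝ := sSup (overlapSet ψ)

/-- The supremum that defines `G(ψ)` is a maximum. -/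
theorem isGreatest_maxOverlap (ψ : ThreeQubit) : IsGreatest (overlapSet ψ) (maxOverlap ψ) := by
  have hcompact : IsCompact (overlapSet ψ) := by
    have hS := isCompact_sphere (0 : Qubit) 1
    have hc : Continuous fun t : Qubit × Qubit × Qubit =>
        ‖inner ℂ (productVector t.1 t.2.1 t.2.2) ψ‖ := by
      unfold productVector
      fun_prop
    have himg := (hS.prod (hS.prod hS)).image hc
    convert himg using 1
    ext r
    constructor
    · rintro ⟨a, b, c, ha, hb, hcc, rfl⟩
      exact ⟨(a, b, c), by simp [ha, hb, hcc], rfl⟩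
    · rintro ⟨⟨a, b, c⟩, hm, rfl⟩
      simp only [Set.mem_prod, mem_sphere_zero_iff_norm] at hm
      exact ⟨a, b, c, hm.1, hm.2.1, hm.2.2, rfl⟩
  refine hcompact.isGreatest_sSup ?_
  exact ⟨_, EuclideanSpace.single 0 1, EuclideanSpace.single 0 1, EuclideanSpace.single 0 1,
    by simp, by simp, by simp, rfl⟩

/-- The geometric measure of entanglement `E_G(ψ) = 1 - G(ψ)²`. -/
def geometricMeasure (ψ : ThreeQubit) : ℝ := 1 - maxOverlap ψ ^ 2

/-- `ψ` is a pure three-qubit state (a unit vector) whose geometric measure of entanglement is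
maximal among all pure three-qubit states. -/
def IsMaximallyEntangled (ψ : ThreeQubit) : Prop :=
  ‖ψ‖ = 1 ∧ ∀ φ : ThreeQubit, ‖φ‖ = 1 → geometricMeasure φ ≤ geometricMeasure ψ

/-- The action of `A ⊗ B ⊗ C` on three-qubit vectors. -/
def localAction (A B C : Matrix (Fin 2) (Fin 2) ℂ) (ψ : ThreeQubit) : ThreeQubit :=
  WithLp.toLp 2 ((A ⊗ₖ (B ⊗ₖ C)).mulVec ψ.ofLp)

/-- `ψ` is obtained from `φ` by a local unitary transformation `A ⊗ B ⊗ C`. -/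
def LocallyUnitarilyEquivalent (ψ φ : ThreeQubit) : Prop :=
  ∃ A ∈ Matrix.unitaryGroup (Fin 2) ℂ, ∃ B ∈ Matrix.unitaryGroup (Fin 2) ℂ,
    ∃ C ∈ Matrix.unitaryGroup (Fin 2) ℂ, ψ = localAction A B C φ

/-- The W state `(|001⟩ + |010⟩ + |100⟩) / √3`. -/
def wState : ThreeQubit :=
  ((1 / Real.sqrt 3 : ℝ) : ℂ) •
    (EuclideanSpace.single (0, 0, 1) 1 + EuclideanSpace.single (0, 1, 0) 1 +
      EuclideanSpace.single (1, 0, 0) 1)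

end

open scoped ComplexConjugate

/-! It suffices that a unit vector with `G ^ 2 ≤ 4 / 9` has `G = 2 / 3` and is locally unitarily
equivalent to W. Local unitaries move a closest product vector to |000⟩. Maximality kills the
amplitudes at 100, 010, 001, and diagonal phases make those at 011, 101, 110 nonnegative
(`exists_normal_form`). After division by G the amplitudes are 1, a, b, c and a complex h at 111,
and no normalized product vector has overlap above 1. Fixing the first factor (1, x) leaves a
bilinear form of bounded norm, hence a determinant inequality (`bilinear_bound`). Restricting x to
the real and imaginary axes turns it into quadratics in one real variable, whose coefficients give
real inequalities on a, b, c, h (`real_conditions_of_overlap_le`). Normalization reads a² + b² + c²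
+ |h|² = 1/G² - 1, so `G ^ 2 ≤ 4 / 9` makes this sum at least 5/4. By `eq_half_of_five_quarters_le`
this forces a = b = c = 1/2 and h = ±i/√2, which are the amplitudes of W seen from a closest product
vector. -/

/-! ### The real inequality behind the bound 5/4. -/

theorem sq_mul_sub_le_of_le_sixth (d q : ℝ) (hd0 : 0 ≤ d) (hq : 0 ≤ q) (hq1 : q ≤ 1 / 6)
    (hdL : d ≤ 3 / 4 - 4 * q + 5 * q ^ 2) :
    d ^ 2 * (3 / 4 - 4 * q + 5 * q ^ 2 - d) ≤ (1 - q) ^ 2 * (1 - 4 * q) ^ 2 / 16 := by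
  set L := 3 / 4 - 4 * q + 5 * q ^ 2 with hL
  have hL0 : 0 ≤ L := hd0.trans hdL
  -- The cubic d²(L - d) peaks at d = 2L/3. Then L³ is bounded by a multiple of L², with L ≤ 3/4 for
  -- q ≤ 1/8 and L ≤ 1/3 beyond.
  have h1 : d ^ 2 * (L - d) ≤ 4 / 27 * L ^ 3 := by
    nlinarith [mul_nonneg (sq_nonneg (d - 2 * L / 3)) (by positivity : 0 ≤ d + L / 3)]
  have h2 : 64 / 27 * L ^ 3 ≤ ((1 - q) * (1 - 4 * q)) ^ 2 := by
    rcases le_total q (1 / 8) with h | h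
    · have hL1 : L ≤ 3 / 4 := by nlinarith
      have h3 : 4 / 3 * L ≤ (1 - q) * (1 - 4 * q) := by nlinarith
      nlinarith [pow_le_pow_left₀ (by positivity) h3 2, mul_nonneg (sq_nonneg L) (sub_nonneg.2 hL1)]
    · have hL1 : L ≤ 1 / 3 := by nlinarith
      have h3 : 8 / 9 * L ≤ (1 - q) * (1 - 4 * q) := by nlinarith
      nlinarith [pow_le_pow_left₀ (by positivity) h3 2, mul_nonneg (sq_nonneg L) (sub_nonneg.2 hL1)]
  nlinarith

/-- The coefficient of the slack 1 - 2q - a in `slack_expansion_le_endpoint`. The constants 2/9, 4/3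
and 25/216 are values at q = 1/6. -/
theorem slack_coeff_pos (a d q : ℝ) (ha : 0 ≤ a) (hd0 : 0 ≤ d) (hq1 : 1 / 6 ≤ q) (h : a + 2 * q ≤ 1)
    (hdL : d ≤ 3 / 4 - 4 * q + 5 * q ^ 2) :
    0 < ((1 - q) ^ 2 + d) * q / 2 - d ^ 2 * (a + 1 - 2 * q) := by
  have hq2 : q ≤ 1 / 2 := by linarith
  have hd2 : d ≤ 2 / 9 := by nlinarith
  have h8 : d ^ 2 * (a + 1 - 2 * q) ≤ d * (2 / 9 * (4 / 3)) := by
    rw [pow_two, mul_assoc]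
    apply mul_le_mul_of_nonneg_left _ hd0
    apply mul_le_mul hd2 (by linarith) (by linarith) (by norm_num)
  have h9 : 25 / 216 ≤ (1 - q) ^ 2 * q := by
    have : 0 ≤ (1 / 2 - q) * (4 / 3 - q) := mul_nonneg (by linarith) (by linarith)
    have : 0 ≤ (q - 1 / 6) * ((1 / 2 - q) * (4 / 3 - q) + 1 / 36) :=
      mul_nonneg (by linarith) (by linarith)
    linarith
  have h10 : d * (1 / 6) ≤ d * q := mul_le_mul_of_nonneg_left hq1 hd0
  linarith

/-- With slack s = 1 - 2q - a, one has 2aq = 1/4 - (1 - 4q)²/4 - 2sq ≤ 1/4. Replacing (2aq)² by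
(1/4)(2aq) leaves an expression organized by (1 - 4q)² and s, both of which vanish at the W values a
= 1/2, q = 1/4. -/
theorem slack_expansion_le_endpoint (a q d : ℝ) (ha : 0 ≤ a) (hq : 0 ≤ q) (h : a + 2 * q ≤ 1)
    (hd : d = a ^ 2 + q ^ 2 - 1 / 4) (hd0 : 0 ≤ d) :
    (((1 - q) ^ 2 + d) / 16 + d ^ 2 / 4) * (1 - 4 * q) ^ 2 + (1 - 2 * q - a) * (((1 - q) ^ 2 + d) * q / 2 - d ^ 2 * (a + 1 - 2 * q)) ≤
     (1 - q) ^ 2 * ((a ^ 2 - q ^ 2) ^ 2 - d * (2 * (a ^ 2 + q ^ 2))) + d * (a ^ 2 - q ^ 2) ^ 2 := by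
  have haq : 2 * a * q = 1 / 4 - ((1 - 4 * q) ^ 2 / 4 + 2 * (1 - 2 * q - a) * q) := by ring
  have h0 : 0 ≤ 2 * a * q := by positivity
  have hs0 : 0 ≤ 1 - 2 * q - a := by linarith
  have hE : 0 ≤ (1 - 4 * q) ^ 2 / 4 + 2 * (1 - 2 * q - a) * q := by positivity
  have h4 : (2 * a * q) ^ 2 ≤ 1 / 4 * (2 * a * q) := by
    rw [pow_two]
    exact mul_le_mul_of_nonneg_right (by linarith) h0
  have hwd : 0 ≤ (1 - q) ^ 2 + d := by positivity
  have h5 := mul_le_mul_of_nonneg_left h4 hwd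
  have e : (1 - q) ^ 2 * ((a ^ 2 - q ^ 2) ^ 2 - d * (2 * (a ^ 2 + q ^ 2))) + d * (a ^ 2 - q ^ 2) ^ 2 =
      (1 - q) ^ 2 / 16 - (1 - q) ^ 2 * d ^ 2 + d * (d + 1 / 4) ^ 2 - ((1 - q) ^ 2 + d) * (2 * a * q) ^ 2 := by
    rw [hd]; ring
  have e2 : (((1 - q) ^ 2 + d) / 16 + d ^ 2 / 4) * (1 - 4 * q) ^ 2 + (1 - 2 * q - a) * (((1 - q) ^ 2 + d) * q / 2 - d ^ 2 * (a + 1 - 2 * q)) =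
      (1 - q) ^ 2 / 16 - (1 - q) ^ 2 * d ^ 2 + d * (d + 1 / 4) ^ 2 - ((1 - q) ^ 2 + d) * (1 / 4 * (2 * a * q)) := by
    rw [hd]; ring
  rw [e, e2]; linarith

/-- The endpoint N = (1 - q)² of the affine function of N used in `eq_half_of_five_quarters_le`. For
q ≤ 1/6 the (1 - 4q)² term absorbs the negative part; for q ≥ 1/6 the slack coefficient is itself
positive. -/
theorem endpoint_polynomial_pos (a q d : ℝ) (ha : 0 ≤ a) (hq : 0 ≤ q) (h : a + 2 * q ≤ 1)
    (hd : d = a ^ 2 + q ^ 2 - 1 / 4) (hd0 : 0 ≤ d)  (hne : ¬ (a = 1 / 2 ∧ q = 1 / 4)) :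
    0 < (1 - q) ^ 2 * ((a ^ 2 - q ^ 2) ^ 2 - d * (2 * (a ^ 2 + q ^ 2))) + d * (a ^ 2 - q ^ 2) ^ 2 := by
  refine lt_of_lt_of_le ?_ (slack_expansion_le_endpoint a q d ha hq h hd hd0)
  have hs0 : 0 ≤ 1 - 2 * q - a := by linarith
  have hsL : (1 - 2 * q - a) * (a + 1 - 2 * q) = 3 / 4 - 4 * q + 5 * q ^ 2 - d := by rw [hd]; ring
  have hdL : d ≤ 3 / 4 - 4 * q + 5 * q ^ 2 := by
    have : 0 ≤ (1 - 2 * q - a) * (a + 1 - 2 * q) := mul_nonneg hs0 (by linarith)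
    linarith
  have hq2 : q ≤ 1 / 2 := by linarith
  have hw : 0 < (1 - q) ^ 2 := by apply pow_pos; linarith
  rcases le_total q (1 / 6) with h6 | h6
  · have h7 := sq_mul_sub_le_of_le_sixth d q hd0 hq h6 hdL
    have hv : 0 < (1 - 4 * q) ^ 2 := by apply pow_pos; linarith
    have h8 : 0 ≤ (1 - 2 * q - a) * (((1 - q) ^ 2 + d) * q / 2) := by positivity
    have e : (1 - 2 * q - a) * (((1 - q) ^ 2 + d) * q / 2 - d ^ 2 * (a + 1 - 2 * q)) =
      (1 - 2 * q - a) * (((1 - q) ^ 2 + d) * q / 2) - d ^ 2 * (3 / 4 - 4 * q + 5 * q ^ 2 - d) := by rw [← hsL]; ring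
    rw [e]
    rcases hd0.eq_or_lt with h0 | h0
    · have : 0 < (1 - q) ^ 2 * (1 - 4 * q) ^ 2 := by positivity
      rw [← h0] at h8 ⊢
      linarith
    · have h7 : 0 < (d / 16 + d ^ 2 / 4) * (1 - 4 * q) ^ 2 := by positivity
      linarith
  · have hbr := slack_coeff_pos a d q ha hd0 h6 h hdL
    rcases hs0.eq_or_lt with h0 | h0
    · have hv : 1 - 4 * q ≠ 0 := by
        intro hv; apply hne; constructor <;> linarith
      have : 0 < (1 - 4 * q) ^ 2 := by positivity
      rw [← h0, zero_mul, add_zero]; positivity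
    · have := mul_pos h0 hbr
      have : 0 ≤ (((1 - q) ^ 2 + d) / 16 + d ^ 2 / 4) * (1 - 4 * q) ^ 2 := by positivity
      linarith

/-- The real inequalities satisfied by the amplitudes of a normalized state in normal form force
`a² + b² + c² + |h|² ≤ 5 / 4` for `h = u + iv`, with equality only at the amplitudes of the W state. -/
theorem eq_half_of_five_quarters_le (a b c u v : ℝ) (ha : 0 ≤ a) (hb : 0 ≤ b) (hc : 0 ≤ c)
    (hK : 0 ≤ 1 - a ^ 2 - b ^ 2 - c ^ 2 - 2 * a * b * c)
    (hN : 0 ≤ (1 - b ^ 2) * (1 - c ^ 2) - (u ^ 2 + v ^ 2))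
    (h0 : (a + b * c) ^ 2 * u ^ 2 ≤ (1 - a ^ 2 - b ^ 2 - c ^ 2 - 2 * a * b * c) * ((1 - b ^ 2) * (1 - c ^ 2) - (u ^ 2 + v ^ 2)))
    (h1 : (a - b * c) ^ 2 * v ^ 2 ≤ (1 - a ^ 2 - b ^ 2 - c ^ 2 + 2 * a * b * c) * ((1 - b ^ 2) * (1 - c ^ 2) - (u ^ 2 + v ^ 2)))
    (hS : 5 / 4 ≤ a ^ 2 + b ^ 2 + c ^ 2 + (u ^ 2 + v ^ 2)) :
    a = 1 / 2 ∧ b = 1 / 2 ∧ c = 1 / 2 ∧ u = 0 ∧ v ^ 2 = 1 / 2 := by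
  obtain ⟨q, hq⟩ : ∃ q, q = b * c := ⟨_, rfl⟩
  obtain ⟨d, hd⟩ : ∃ d, d = a ^ 2 + q ^ 2 - 1 / 4 := ⟨_, rfl⟩
  obtain ⟨N, hNd⟩ : ∃ N, N = (1 - b ^ 2) * (1 - c ^ 2) := ⟨_, rfl⟩
  obtain ⟨p, hp⟩ : ∃ p, p = u ^ 2 + v ^ 2 := ⟨_, rfl⟩
  have hq0 : 0 ≤ q := hq ▸ mul_nonneg hb hc
  have hK0 : 1 - a ^ 2 - b ^ 2 - c ^ 2 - 2 * a * b * c = N - (a + q) ^ 2 := by rw [hNd, hq]; ring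
  have hK1 : 1 - a ^ 2 - b ^ 2 - c ^ 2 + 2 * a * b * c = N - (a - q) ^ 2 := by rw [hNd, hq]; ring
  rw [← hNd, ← hp, ← hq, hK0] at h0
  rw [← hNd, ← hp, ← hq, hK1] at h1
  rw [← hNd, ← hp] at hN
  rw [hK0] at hK
  have hNp : N - p ≤ d := by
    have : N = 1 - b ^ 2 - c ^ 2 + q ^ 2 := by rw [hNd, hq]; ring
    linarith
  have hd0 : 0 ≤ d := hN.trans hNp
  have hbc : N = (1 - q) ^ 2 - (b - c) ^ 2 := by rw [hNd, hq]; ring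
  have hNw : N ≤ (1 - q) ^ 2 := by linarith [sq_nonneg (b - c)]
  have hq1 : q ≤ 1 := by
    have h2 := sq_nonneg (b - c)
    have : 0 ≤ a * b * c := by positivity
    have : 0 ≤ a ^ 2 := sq_nonneg a
    rw [hq]; linarith
  have haq : a + 2 * q ≤ 1 := by
    have : a + q ≤ 1 - q := abs_le_of_sq_le_sq' (by linarith) (by linarith) |>.2
    linarith
  -- Weighting the two inequalities by (a - q)² and (a + q)² lets u² and v² enter only through p;
  -- then N - p is replaced by its upper bound d.
  have hcomb : N * ((a ^ 2 - q ^ 2) ^ 2 - d * (2 * (a ^ 2 + q ^ 2))) + d * (a ^ 2 - q ^ 2) ^ 2 ≤ 0 := by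
    have e1 := mul_le_mul_of_nonneg_left h0 (sq_nonneg (a - q))
    have e2 := mul_le_mul_of_nonneg_left h1 (sq_nonneg (a + q))
    have e3 : (N - p) * (N * (2 * (a ^ 2 + q ^ 2)) - (a ^ 2 - q ^ 2) ^ 2) ≥ N * (a ^ 2 - q ^ 2) ^ 2 := by
      have : (a - q) ^ 2 * (a + q) ^ 2 * p ≤ (N - p) * (N * (2 * (a ^ 2 + q ^ 2)) - 2 * ((a - q) ^ 2 * (a + q) ^ 2)) := by
        rw [hp] at e1 e2 ⊢
        linarith
      have e : (a ^ 2 - q ^ 2) ^ 2 = (a - q) ^ 2 * (a + q) ^ 2 := by ring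
      rw [e]; linarith
    have e4 : 0 ≤ N * (2 * (a ^ 2 + q ^ 2)) - (a ^ 2 - q ^ 2) ^ 2 := by
      have t1 : 0 ≤ (N - (a + q) ^ 2) * (2 * (a ^ 2 + q ^ 2)) := by positivity
      have t2 : 0 ≤ (a + q) ^ 4 := by positivity
      linarith
    have e5 := mul_le_mul_of_nonneg_right hNp e4
    linarith
  -- The left side of `hcomb` is affine in N, and (a + q)² ≤ N ≤ (1 - q)². Away from the W values it
  -- is positive at both ends, contradicting `hcomb`.
  have heq : a = 1 / 2 ∧ q = 1 / 4 := by
    by_contra hne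
    have hk := endpoint_polynomial_pos a q d ha hq0 haq hd hd0 hne
    have hA0 : 0 < (a + q) ^ 2 := by
      have : 0 ≤ a * q := by positivity
      linarith
    have haq8 : a * q ≤ 1 / 8 := by
      have := mul_le_mul_of_nonneg_right haq hq0
      linarith [sq_nonneg (1 - 4 * q)]
    have hA : 0 ≤ (a + q) ^ 2 * ((a ^ 2 - q ^ 2) ^ 2 - d * (2 * (a ^ 2 + q ^ 2))) + d * (a ^ 2 - q ^ 2) ^ 2 := by
      have e : (a + q) ^ 2 * ((a ^ 2 - q ^ 2) ^ 2 - d * (2 * (a ^ 2 + q ^ 2))) + d * (a ^ 2 - q ^ 2) ^ 2 =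
        ((a + q) ^ 2) ^ 2 * (1 / 4 - 2 * (a * q)) := by rw [hd]; ring
      rw [e]; apply mul_nonneg (by positivity); linarith
    have hA' : (a + q) ^ 2 * ((a ^ 2 - q ^ 2) ^ 2 - d * (2 * (a ^ 2 + q ^ 2))) + d * (a ^ 2 - q ^ 2) ^ 2 ≠ 0 := by
      have e : (a + q) ^ 2 * ((a ^ 2 - q ^ 2) ^ 2 - d * (2 * (a ^ 2 + q ^ 2))) + d * (a ^ 2 - q ^ 2) ^ 2 =
        ((a + q) ^ 2) ^ 2 * (1 / 4 - 2 * (a * q)) := by rw [hd]; ring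
      rw [e]
      refine mul_ne_zero (by positivity) fun h2 => hne ?_
      have := mul_le_mul_of_nonneg_right haq hq0
      have h3 : (1 - 4 * q) ^ 2 = 0 := le_antisymm (by linarith) (sq_nonneg _)
      have h4 : q = 1 / 4 := by
        have := pow_eq_zero_iff (two_ne_zero) |>.1 h3
        linarith
      rw [h4] at h2
      exact ⟨by linarith, h4⟩
    have hA2 := lt_of_le_of_ne hA hA'.symm
    rcases le_total 0 ((a ^ 2 - q ^ 2) ^ 2 - d * (2 * (a ^ 2 + q ^ 2))) with hc1 | hc1
    · have := mul_le_mul_of_nonneg_right hK hc1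
      linarith
    · have := mul_le_mul_of_nonpos_right hNw hc1
      linarith
  obtain ⟨ha2, hq2⟩ := heq
  have hd2 : d = 1 / 16 := by rw [hd, ha2, hq2]; norm_num
  rw [ha2, hq2] at hK h0 h1
  rw [hq2] at hbc
  have hbc0 : (b - c) ^ 2 = 0 := le_antisymm (by linarith) (sq_nonneg _)
  have hbc1 : b = c := by
    have := pow_eq_zero_iff (two_ne_zero) |>.1 hbc0
    linarith
  have hb2 : b = 1 / 2 := by
    subst hbc1
    have : b ^ 2 = (1 / 2) ^ 2 := by rw [pow_two, ← hq, hq2]; norm_num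
    exact (pow_left_inj₀ hb (by norm_num) two_ne_zero).1 this
  have hNv : N = 9 / 16 := by rw [hbc, hbc0]; norm_num
  have hu2 : u ^ 2 = 0 := by
    rw [hNv] at h0
    exact le_antisymm (by linarith) (sq_nonneg _)
  refine ⟨ha2, hb2, hbc1 ▸ hb2, by simpa using hu2, ?_⟩
  rw [hNv] at hNp h1
  rw [hu2] at hp
  linarith

/-! ### From overlap bounds to real inequalities. -/

open Complex

/-- A nonnegative binary Hermitian form has nonnegative determinant. -/
theorem hermitian_det_nonneg (P Q : ℝ) (R : ℂ)
    (H : ∀ z w : ℂ, 0 ≤ P * normSq z + Q * normSq w - 2 * (R * z * conj w).re) :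
    0 ≤ P * Q - normSq R := by
  have hP : 0 ≤ P := by simpa using H 1 0
  have hQ : 0 ≤ Q := by simpa using H 0 1
  -- These vectors give P and Q times the determinant; the third settles P = Q = 0.
  have h1 := H (conj R) P
  have h2 := H Q R
  have h3 := H (conj R) 1
  simp only [normSq_apply, mul_re, mul_im, conj_re, conj_im, ofReal_re, ofReal_im, one_re,
    one_im] at h1 h2 h3 ⊢
  by_contra! hc
  have hP0 : P = 0 := by
    by_contra hne
    have : 0 < P := lt_of_le_of_ne hP (Ne.symm hne)
    have := mul_neg_of_pos_of_neg this hc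
    linarith
  have hQ0 : Q = 0 := by
    by_contra hne
    have : 0 < Q := lt_of_le_of_ne hQ (Ne.symm hne)
    have := mul_neg_of_pos_of_neg this hc
    linarith
  subst hP0 hQ0
  linarith

/-- The determinant condition for a bilinear form on `ℂ² × ℂ²` of norm at most `√s`. -/
theorem bilinear_bound (m n k l : ℂ) (s : ℝ) (hs : 0 ≤ s)
    (H : ∀ y₀ y₁ z₀ z₁ : ℂ, normSq (m * y₀ * z₀ + n * y₀ * z₁ + k * y₁ * z₀ + l * y₁ * z₁) ≤
      s * (normSq y₀ + normSq y₁) * (normSq z₀ + normSq z₁)) :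
    0 ≤ s ^ 2 - s * (normSq m + normSq n + normSq k + normSq l) + normSq (m * l - n * k) := by
  have h1 : ∀ z₀ z₁ : ℂ, normSq (m * z₀ + n * z₁) + normSq (k * z₀ + l * z₁) ≤
      s * (normSq z₀ + normSq z₁) := by
    intro z₀ z₁
    obtain ⟨r₀, hr₀⟩ : ∃ r, r = m * z₀ + n * z₁ := ⟨_, rfl⟩
    obtain ⟨r₁, hr₁⟩ : ∃ r, r = k * z₀ + l * z₁ := ⟨_, rfl⟩
    -- The conjugate of the image of z is the optimal y, so the bilinear bound becomes a bound on a
    -- Hermitian form in z.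
    have h := H (conj r₀) (conj r₁) z₀ z₁
    have e : m * conj r₀ * z₀ + n * conj r₀ * z₁ + k * conj r₁ * z₀ + l * conj r₁ * z₁ =
        ((normSq r₀ + normSq r₁ : ℝ) : ℂ) := by
      push_cast
      rw [← mul_conj r₀, ← mul_conj r₁]
      nth_rw 3 [hr₀]
      nth_rw 3 [hr₁]
      ring
    rw [e, normSq_ofReal, normSq_conj, normSq_conj] at h
    rw [← hr₀, ← hr₁]
    have h0 : 0 ≤ normSq r₀ + normSq r₁ := add_nonneg (normSq_nonneg _) (normSq_nonneg _)
    rcases h0.eq_or_lt with h0 | h0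
    · rw [← h0]
      exact mul_nonneg hs (add_nonneg (normSq_nonneg _) (normSq_nonneg _))
    · refine le_of_mul_le_mul_left ?_ h0
      linarith
  have h2 := hermitian_det_nonneg (s - normSq m - normSq k) (s - normSq n - normSq l)
    (m * conj n + k * conj l) (fun z w => by
      have h := h1 z w
      simp only [normSq_apply, mul_re, mul_im, add_re, add_im, conj_re, conj_im] at h ⊢
      linarith)
  refine h2.trans_eq ?_
  simp only [normSq_apply, mul_re, mul_im, add_re, add_im, sub_re, sub_im, conj_re, conj_im]
  ring

theorem quadratic_nonneg_of_ne_zero (k m n : ℝ)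
    (H : ∀ t : ℝ, t ≠ 0 → 0 ≤ k + 2 * m * t + n * t ^ 2) (t : ℝ) :
    0 ≤ k + 2 * m * t + n * t ^ 2 := by
  have hd : Dense {t : ℝ | t ≠ 0} := dense_compl_singleton 0
  have hcl : IsClosed {t : ℝ | 0 ≤ k + 2 * m * t + n * t ^ 2} :=
    isClosed_le (by fun_prop) (by fun_prop)
  exact hcl.closure_subset_iff.2 (fun t ht => H t ht) (hd t)

/-- The point t = 0 is excluded because the quadratics arise after cancelling t²; continuity
restores it. Substituting 1/t exchanges the roles of k and n. -/
theorem coeff_conditions_of_quadratic_nonneg (k m n : ℝ)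
    (H : ∀ t : ℝ, t ≠ 0 → 0 ≤ k + 2 * m * t + n * t ^ 2) :
    0 ≤ k ∧ 0 ≤ n ∧ m ^ 2 ≤ k * n := by
  have hall := quadratic_nonneg_of_ne_zero k m n H
  have hdisc := discrim_le_zero (a := n) (b := 2 * m) (c := k) fun t => by
    linarith [hall t]
  rw [discrim] at hdisc
  have hrev := quadratic_nonneg_of_ne_zero n m k (fun t ht => by
    have h1 := mul_nonneg (sq_nonneg t) (H t⁻¹ (inv_ne_zero ht))
    have e : t ^ 2 * (k + 2 * m * t⁻¹ + n * t⁻¹ ^ 2) = n + 2 * m * t + k * t ^ 2 := by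
      field_simp
      ring
    rwa [e] at h1) 0
  exact ⟨by simpa using hall 0, by simpa using hrev, by linarith⟩

/-- The inequalities on the amplitudes of a vector in normal form whose overlap with every product
vector is at most its overlap `1` with `|000⟩`. -/
theorem real_conditions_of_overlap_le (a b c : ℝ) (h : ℂ)
    (H : ∀ x y₀ y₁ z₀ z₁ : ℂ,
      normSq (y₀ * z₀ + a * y₁ * z₁ + b * x * y₀ * z₁ + c * x * y₁ * z₀ + h * x * y₁ * z₁) ≤
      (1 + normSq x) * (normSq y₀ + normSq y₁) * (normSq z₀ + normSq z₁)) :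
    0 ≤ 1 - a^2 - b^2 - c^2 - 2*a*b*c ∧ 0 ≤ (1-b^2)*(1-c^2) - (h.re^2+h.im^2) ∧
    (a+b*c)^2*h.re^2 ≤
      (1 - a^2 - b^2 - c^2 - 2*a*b*c)*((1-b^2)*(1-c^2) - (h.re^2+h.im^2)) ∧
    (a-b*c)^2*h.im^2 ≤
      (1 - a^2 - b^2 - c^2 + 2*a*b*c)*((1-b^2)*(1-c^2) - (h.re^2+h.im^2)) := by
  have key : ∀ x : ℂ, 0 ≤ (1 + normSq x) ^ 2 - (1 + normSq x) *
      (normSq (1 : ℂ) + normSq (b * x) + normSq (c * x) + normSq (a + h * x)) +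
      normSq (1 * (a + h * x) - b * x * (c * x)) := fun x =>
    bilinear_bound 1 (b * x) (c * x) (a + h * x) (1 + normSq x)
      (by linarith [normSq_nonneg x]) fun y₀ y₁ z₀ z₁ => by
        refine le_trans (le_of_eq ?_) (H x y₀ y₁ z₀ z₁)
        congr 1; ring
  obtain ⟨hk, hn, h0⟩ := coeff_conditions_of_quadratic_nonneg (1 - a^2 - b^2 - c^2 - 2*a*b*c)
    (-((a + b * c) * h.re)) ((1-b^2)*(1-c^2) - (h.re^2+h.im^2)) fun t ht => by
      have := key t
      simp only [normSq_apply, mul_re, mul_im, add_re, add_im, sub_re, sub_im, one_re, one_im,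
        ofReal_re, ofReal_im] at this
      have ht2 : 0 < t ^ 2 := by positivity
      refine le_of_mul_le_mul_left ?_ ht2
      linarith
  obtain ⟨-, -, h1⟩ := coeff_conditions_of_quadratic_nonneg (1 - a^2 - b^2 - c^2 + 2*a*b*c)
    ((a - b * c) * h.im) ((1-b^2)*(1-c^2) - (h.re^2+h.im^2)) fun t ht => by
      -- Here x² = -t², which flips the sign of bc relative to a.
      have := key (t * I)
      simp only [normSq_apply, mul_re, mul_im, add_re, add_im, sub_re, sub_im, one_re, one_im,
        ofReal_re, ofReal_im, I_re, I_im] at this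
      have ht2 : 0 < t ^ 2 := by positivity
      refine le_of_mul_le_mul_left ?_ ht2
      linarith
  refine ⟨hk, hn, ?_, ?_⟩ <;> linarith

/-! ### Local unitaries and invariance of the overlap. -/

theorem inner_productVector (a b c : Qubit) (ψ : ThreeQubit) :
    inner ℂ (productVector a b c) ψ =
      ∑ i, ∑ j, ∑ k, conj (a i) * conj (b j) * conj (c k) * ψ (i, j, k) := by
  simp only [PiLp.inner_apply, productVector, Fintype.sum_prod_type, RCLike.inner_apply, map_mul]
  refine Finset.sum_congr rfl fun i _ => Finset.sum_congr rfl fun j _ =>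
    Finset.sum_congr rfl fun k _ => by ring

theorem localAction_localAction (A B C A' B' C' : Matrix (Fin 2) (Fin 2) ℂ) (ψ : ThreeQubit) :
    localAction A B C (localAction A' B' C' ψ) = localAction (A * A') (B * B') (C * C') ψ := by
  simp [localAction, Matrix.mulVec_mulVec, Matrix.mul_kronecker_mul]

theorem localAction_one (ψ : ThreeQubit) : localAction 1 1 1 ψ = ψ := by
  simp [localAction]

theorem localAction_apply (A B C : Matrix (Fin 2) (Fin 2) ℂ) (ψ : ThreeQubit) (i j k : Fin 2) :
    localAction A B C ψ (i, j, k) = ∑ l, ∑ m, ∑ n, A i l * B j m * C k n * ψ (l, m, n) := by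
  simp only [localAction, Matrix.mulVec, dotProduct, Fintype.sum_prod_type,
    Matrix.kroneckerMap_apply]
  refine Finset.sum_congr rfl fun i _ => Finset.sum_congr rfl fun j _ =>
    Finset.sum_congr rfl fun k _ => by ring

/-- A matrix acting on a qubit. -/
def qubitAction (A : Matrix (Fin 2) (Fin 2) ℂ) (a : Qubit) : Qubit :=
  WithLp.toLp 2 (A.mulVec a.ofLp)

theorem norm_toLp_mulVec {ι : Type*} [Fintype ι] [DecidableEq ι] {U : Matrix ι ι ℂ}
    (hU : U ∈ Matrix.unitaryGroup ι ℂ) (v : EuclideanSpace ℂ ι) :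
    ‖WithLp.toLp 2 (U.mulVec v.ofLp)‖ = ‖v‖ := by
  have h : inner ℂ (WithLp.toLp 2 (U.mulVec v.ofLp)) (WithLp.toLp 2 (U.mulVec v.ofLp)) =
      inner ℂ v v := by
    rw [EuclideanSpace.inner_eq_star_dotProduct, EuclideanSpace.inner_eq_star_dotProduct]
    simp only
    rw [Matrix.star_mulVec, dotProduct_comm, ← Matrix.dotProduct_mulVec, Matrix.mulVec_mulVec,
      ← Matrix.star_eq_conjTranspose, (Matrix.mem_unitaryGroup_iff').1 hU, Matrix.one_mulVec,
      dotProduct_comm]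
  rw [inner_self_eq_norm_sq_to_K, inner_self_eq_norm_sq_to_K] at h
  have h2 : ‖WithLp.toLp 2 (U.mulVec v.ofLp)‖ ^ 2 = ‖v‖ ^ 2 := by exact_mod_cast h
  exact (pow_left_inj₀ (norm_nonneg _) (norm_nonneg _) two_ne_zero).1 h2

theorem kronecker_mem_unitary {A B C : Matrix (Fin 2) (Fin 2) ℂ}
    (hA : A ∈ Matrix.unitaryGroup (Fin 2) ℂ) (hB : B ∈ Matrix.unitaryGroup (Fin 2) ℂ)
    (hC : C ∈ Matrix.unitaryGroup (Fin 2) ℂ) :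
    A ⊗ₖ (B ⊗ₖ C) ∈ Matrix.unitaryGroup (Fin 2 × Fin 2 × Fin 2) ℂ :=
  Matrix.kronecker_mem_unitary hA (Matrix.kronecker_mem_unitary hB hC)

theorem norm_localAction {A B C : Matrix (Fin 2) (Fin 2) ℂ}
    (hA : A ∈ Matrix.unitaryGroup (Fin 2) ℂ) (hB : B ∈ Matrix.unitaryGroup (Fin 2) ℂ)
    (hC : C ∈ Matrix.unitaryGroup (Fin 2) ℂ) (ψ : ThreeQubit) :
    ‖localAction A B C ψ‖ = ‖ψ‖ :=
  norm_toLp_mulVec (kronecker_mem_unitary hA hB hC) ψ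

theorem inner_productVector_localAction (A B C : Matrix (Fin 2) (Fin 2) ℂ) (a b c : Qubit)
    (ψ : ThreeQubit) :
    inner ℂ (productVector a b c) (localAction A B C ψ) =
      inner ℂ (productVector (qubitAction (star A) a) (qubitAction (star B) b)
        (qubitAction (star C) c)) ψ := by
  rw [inner_productVector, inner_productVector]
  simp only [localAction_apply, qubitAction, Matrix.mulVec, dotProduct, Fin.sum_univ_two,
    Matrix.star_apply, map_add, map_mul, RCLike.star_def, conj_conj]
  ring

theorem overlapSet_localAction_subset {A B C : Matrix (Fin 2) (Fin 2) ℂ}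
    (hA : A ∈ Matrix.unitaryGroup (Fin 2) ℂ) (hB : B ∈ Matrix.unitaryGroup (Fin 2) ℂ)
    (hC : C ∈ Matrix.unitaryGroup (Fin 2) ℂ) (ψ : ThreeQubit) :
    overlapSet (localAction A B C ψ) ⊆ overlapSet ψ := by
  rintro r ⟨a, b, c, ha, hb, hc, rfl⟩
  exact ⟨qubitAction (star A) a, qubitAction (star B) b, qubitAction (star C) c,
    (norm_toLp_mulVec (Unitary.star_mem hA) a).trans ha,
    (norm_toLp_mulVec (Unitary.star_mem hB) b).trans hb,
    (norm_toLp_mulVec (Unitary.star_mem hC) c).trans hc,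
    by rw [inner_productVector_localAction]⟩

theorem localAction_star_localAction {A B C : Matrix (Fin 2) (Fin 2) ℂ}
    (hA : A ∈ Matrix.unitaryGroup (Fin 2) ℂ) (hB : B ∈ Matrix.unitaryGroup (Fin 2) ℂ)
    (hC : C ∈ Matrix.unitaryGroup (Fin 2) ℂ) (ψ : ThreeQubit) :
    localAction (star A) (star B) (star C) (localAction A B C ψ) = ψ := by
  rw [localAction_localAction, (Matrix.mem_unitaryGroup_iff').1 hA,
    (Matrix.mem_unitaryGroup_iff').1 hB, (Matrix.mem_unitaryGroup_iff').1 hC, localAction_one]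

theorem maxOverlap_localAction {A B C : Matrix (Fin 2) (Fin 2) ℂ}
    (hA : A ∈ Matrix.unitaryGroup (Fin 2) ℂ) (hB : B ∈ Matrix.unitaryGroup (Fin 2) ℂ)
    (hC : C ∈ Matrix.unitaryGroup (Fin 2) ℂ) (ψ : ThreeQubit) :
    maxOverlap (localAction A B C ψ) = maxOverlap ψ := by
  unfold maxOverlap
  congr 1
  refine (overlapSet_localAction_subset hA hB hC ψ).antisymm ?_
  conv_lhs => rw [← localAction_star_localAction hA hB hC ψ]
  exact overlapSet_localAction_subset (Unitary.star_mem hA) (Unitary.star_mem hB)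
    (Unitary.star_mem hC) _

theorem LocallyUnitarilyEquivalent.symm {ψ φ : ThreeQubit}
    (h : LocallyUnitarilyEquivalent ψ φ) : LocallyUnitarilyEquivalent φ ψ := by
  obtain ⟨A, hA, B, hB, C, hC, rfl⟩ := h
  exact ⟨star A, Unitary.star_mem hA, star B, Unitary.star_mem hB, star C, Unitary.star_mem hC,
    (localAction_star_localAction hA hB hC φ).symm⟩

theorem LocallyUnitarilyEquivalent.trans {ψ φ χ : ThreeQubit}
    (h : LocallyUnitarilyEquivalent ψ φ) (h' : LocallyUnitarilyEquivalent φ χ) :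
    LocallyUnitarilyEquivalent ψ χ := by
  obtain ⟨A, hA, B, hB, C, hC, rfl⟩ := h
  obtain ⟨A', hA', B', hB', C', hC', rfl⟩ := h'
  exact ⟨A * A', mul_mem hA hA', B * B', mul_mem hB hB', C * C', mul_mem hC hC',
    localAction_localAction ..⟩

theorem LocallyUnitarilyEquivalent.norm_eq {ψ φ : ThreeQubit}
    (h : LocallyUnitarilyEquivalent ψ φ) : ‖ψ‖ = ‖φ‖ := by
  obtain ⟨A, hA, B, hB, C, hC, rfl⟩ := h
  exact norm_localAction hA hB hC φ

theorem LocallyUnitarilyEquivalent.maxOverlap_eq {ψ φ : ThreeQubit}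
    (h : LocallyUnitarilyEquivalent ψ φ) : maxOverlap ψ = maxOverlap φ := by
  obtain ⟨A, hA, B, hB, C, hC, rfl⟩ := h
  exact maxOverlap_localAction hA hB hC φ

theorem maxOverlap_nonneg (ψ : ThreeQubit) : 0 ≤ maxOverlap ψ := by
  obtain ⟨a, b, c, -, -, -, h⟩ := (isGreatest_maxOverlap ψ).1
  rw [h]
  exact norm_nonneg _

/-- Homogeneous form of the maximality of `maxOverlap`, free of unit vectors and conjugations. -/
theorem normSq_sum_le (ψ : ThreeQubit) (x y z : Fin 2 → ℂ) :
    normSq (∑ i, ∑ j, ∑ k, x i * y j * z k * ψ (i, j, k)) ≤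
      maxOverlap ψ ^ 2 * (normSq (x 0) + normSq (x 1)) * (normSq (y 0) + normSq (y 1)) *
        (normSq (z 0) + normSq (z 1)) := by
  have hn : ∀ x : Fin 2 → ℂ, ‖(WithLp.toLp 2 fun i => conj (x i) : Qubit)‖ ^ 2 =
      normSq (x 0) + normSq (x 1) := fun x => by
    rw [EuclideanSpace.norm_sq_eq, Fin.sum_univ_two]
    simp [normSq_eq_norm_sq]
  have hunit : ∀ x : Fin 2 → ℂ, ∃ (u : Qubit) (r : ℝ), 0 ≤ r ∧ ‖u‖ = 1 ∧
      r ^ 2 = normSq (x 0) + normSq (x 1) ∧ ∀ i, x i = r * conj (u i) := by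
    intro x
    obtain ⟨v, hv⟩ : ∃ v : Qubit, v = WithLp.toLp 2 fun i => conj (x i) := ⟨_, rfl⟩
    by_cases h0 : v = 0
    · refine ⟨EuclideanSpace.single 0 1, 0, le_rfl, by simp, ?_, fun i => ?_⟩
      · rw [← hn, ← hv, h0]; simp
      · have := congrArg (fun w : Qubit => conj (w i)) (hv.symm.trans h0)
        simpa using this
    · have h1 : ‖v‖ ≠ 0 := norm_ne_zero_iff.2 h0
      refine ⟨((‖v‖⁻¹ : ℝ) : ℂ) • v, ‖v‖, norm_nonneg _, ?_, by rw [hv, hn], fun i => ?_⟩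
      · rw [norm_smul]; simp [h1]
      · have : ((‖v‖ : ℝ) : ℂ) ≠ 0 := by exact_mod_cast h1
        have e : x i = conj (v i) := by rw [hv]; simp
        rw [e]
        simp only [PiLp.smul_apply, smul_eq_mul, map_mul, conj_ofReal]
        push_cast
        field_simp
  obtain ⟨u, r, hr, hu, hru, hxu⟩ := hunit x
  obtain ⟨v, s, hs, hv, hsv, hyv⟩ := hunit y
  obtain ⟨w, t, ht, hw, htw, hzw⟩ := hunit z
  have hle := (isGreatest_maxOverlap ψ).2 ⟨u, v, w, hu, hv, hw, rfl⟩
  have e : ∑ i, ∑ j, ∑ k, x i * y j * z k * ψ (i, j, k) =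
      ((r * s * t : ℝ) : ℂ) * inner ℂ (productVector u v w) ψ := by
    rw [inner_productVector]
    simp only [hxu, hyv, hzw, Fin.sum_univ_two]
    push_cast
    ring
  rw [e, map_mul, normSq_ofReal, ← hru, ← hsv, ← htw, normSq_eq_norm_sq]
  have h2 := pow_le_pow_left₀ (norm_nonneg _) hle 2
  have h3 := mul_le_mul_of_nonneg_left h2 (sq_nonneg (r * s * t))
  linarith

/-! ### Normal form at a closest product vector. -/

theorem exists_unitary_col_zero (a : Qubit) (ha : ‖a‖ = 1) :
    ∃ U ∈ Matrix.unitaryGroup (Fin 2) ℂ, ∀ i, U i 0 = a i := by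
  have h : normSq (a 0) + normSq (a 1) = 1 := by
    have := EuclideanSpace.norm_sq_eq a
    rw [ha, Fin.sum_univ_two] at this
    simp only [normSq_eq_norm_sq]
    linarith
  have hc : (normSq (a 0) : ℂ) + normSq (a 1) = 1 := by exact_mod_cast h
  rw [← mul_conj, ← mul_conj] at hc
  refine ⟨!![a 0, -conj (a 1); a 1, conj (a 0)], ?_, fun i => by fin_cases i <;> simp⟩
  rw [Matrix.mem_unitaryGroup_iff']
  ext i j
  fin_cases i <;> fin_cases j <;>
    simp [Matrix.mul_apply, Fin.sum_univ_two, Matrix.star_apply]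
  · linear_combination hc
  · ring
  · ring
  · linear_combination hc

/-- Replaces the first-order condition at a maximum: testing against the conjugate of (g, t) itself
gives (|g|² + |t|²)² ≤ |g|²(|g|² + |t|²). -/
theorem eq_zero_of_normSq_le {g t : ℂ} {G : ℝ} (hg : ‖g‖ = G)
    (h : normSq (conj g * g + conj t * t) ≤ G ^ 2 * (normSq g + normSq t)) : t = 0 := by
  have e : conj g * g + conj t * t = ((normSq g + normSq t : ℝ) : ℂ) := by
    push_cast
    rw [← mul_conj, ← mul_conj]
    ring
  rw [e, normSq_ofReal, ← hg, ← normSq_eq_norm_sq] at h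
  have h1 := normSq_nonneg g
  have h2 := normSq_nonneg t
  have h3 := mul_nonneg h1 h2
  have h4 : normSq t * normSq t = 0 := le_antisymm (by linarith) (mul_nonneg h2 h2)
  simpa using h4

theorem exists_locallyUnitarilyEquivalent_vanishing (ψ : ThreeQubit) :
    ∃ φ : ThreeQubit, LocallyUnitarilyEquivalent φ ψ ∧ ‖φ (0, 0, 0)‖ = maxOverlap ψ ∧
      φ (1, 0, 0) = 0 ∧ φ (0, 1, 0) = 0 ∧ φ (0, 0, 1) = 0 := by
  obtain ⟨a, b, c, ha, hb, hc, h⟩ := (isGreatest_maxOverlap ψ).1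
  obtain ⟨U, hU, hUa⟩ := exists_unitary_col_zero a ha
  obtain ⟨V, hV, hVb⟩ := exists_unitary_col_zero b hb
  obtain ⟨W, hW, hWc⟩ := exists_unitary_col_zero c hc
  obtain ⟨φ, hφ⟩ : ∃ φ, φ = localAction (star U) (star V) (star W) ψ := ⟨_, rfl⟩
  have hLU : LocallyUnitarilyEquivalent φ ψ :=
    ⟨star U, Unitary.star_mem hU, star V, Unitary.star_mem hV, star W, Unitary.star_mem hW, hφ⟩
  have h0 : ‖φ (0, 0, 0)‖ = maxOverlap ψ := by
    rw [h, hφ, localAction_apply, inner_productVector]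
    simp only [Matrix.star_apply, hUa, hVb, hWc, RCLike.star_def]
  have hle := normSq_sum_le φ
  rw [hLU.maxOverlap_eq] at hle
  refine ⟨φ, hLU, h0, ?_, ?_, ?_⟩ <;> apply eq_zero_of_normSq_le h0
  · simpa [Fin.sum_univ_two] using
      hle ![conj (φ (0, 0, 0)), conj (φ (1, 0, 0))] ![1, 0] ![1, 0]
  · simpa [Fin.sum_univ_two] using
      hle ![1, 0] ![conj (φ (0, 0, 0)), conj (φ (0, 1, 0))] ![1, 0]
  · simpa [Fin.sum_univ_two] using
      hle ![1, 0] ![1, 0] ![conj (φ (0, 0, 0)), conj (φ (0, 0, 1))]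

theorem diagonal_exp_mem_unitary (s t : ℝ) :
    Matrix.diagonal ![exp (s * I), exp (t * I)] ∈ Matrix.unitaryGroup (Fin 2) ℂ := by
  have h : ∀ r : ℝ, conj (exp (r * I)) * exp (r * I) = 1 := fun r => by
    rw [← exp_conj, ← exp_add]; simp
  rw [Matrix.mem_unitaryGroup_iff']
  ext i j
  fin_cases i <;> fin_cases j <;> simp [Matrix.mul_apply, Matrix.star_apply, h]

theorem exp_mul_eq_norm {t : ℝ} {z : ℂ} (h : t + arg z = 0) : exp (t * I) * z = ‖z‖ := by
  have e : exp (t * I) * exp (arg z * I) = 1 := by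
    rw [← exp_add, ← add_mul]
    have : (t : ℂ) + arg z = 0 := by exact_mod_cast h
    simp [this]
  calc exp (t * I) * z = ‖z‖ * (exp (t * I) * exp (arg z * I)) := by
        nth_rw 1 [← norm_mul_exp_arg_mul_I z]; ring
    _ = ‖z‖ := by rw [e, mul_one]

/-- The Schmidt-type normal form of a three-qubit vector at a closest product vector. -/
theorem exists_normal_form (ψ : ThreeQubit) :
    ∃ (φ : ThreeQubit) (a b c : ℝ), LocallyUnitarilyEquivalent φ ψ ∧
      0 ≤ a ∧ 0 ≤ b ∧ 0 ≤ c ∧ φ (0, 0, 0) = maxOverlap ψ ∧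
      φ (1, 0, 0) = 0 ∧ φ (0, 1, 0) = 0 ∧ φ (0, 0, 1) = 0 ∧
      φ (0, 1, 1) = a ∧ φ (1, 0, 1) = b ∧ φ (1, 1, 0) = c := by
  obtain ⟨φ, hLU, h0, h1, h2, h3⟩ := exists_locallyUnitarilyEquivalent_vanishing ψ
  obtain ⟨s, hs⟩ : ∃ s, s = -arg (φ (0, 0, 0)) := ⟨_, rfl⟩
  obtain ⟨A, hA⟩ : ∃ A, A = -arg (φ (0, 1, 1)) - s := ⟨_, rfl⟩
  obtain ⟨B, hB⟩ : ∃ B, B = -arg (φ (1, 0, 1)) - s := ⟨_, rfl⟩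
  obtain ⟨C, hC⟩ : ∃ C, C = -arg (φ (1, 1, 0)) - s := ⟨_, rfl⟩
  -- The half-sums solve for total phases s, s + A, s + B, s + C at 000, 011, 101, 110. The phase at
  -- 111 is then no longer free.
  refine ⟨localAction (Matrix.diagonal ![exp ((s : ℝ) * I), exp ((s + (B + C - A) / 2 : ℝ) * I)])
    (Matrix.diagonal ![exp ((0 : ℝ) * I), exp (((A + C - B) / 2 : ℝ) * I)])
    (Matrix.diagonal ![exp ((0 : ℝ) * I), exp (((A + B - C) / 2 : ℝ) * I)]) φ,
    ‖φ (0, 1, 1)‖, ‖φ (1, 0, 1)‖, ‖φ (1, 1, 0)‖, LocallyUnitarilyEquivalent.trans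
      ⟨_, diagonal_exp_mem_unitary _ _, _, diagonal_exp_mem_unitary _ _, _,
        diagonal_exp_mem_unitary _ _, rfl⟩ hLU,
    norm_nonneg _, norm_nonneg _, norm_nonneg _, ?_, ?_, ?_, ?_, ?_, ?_, ?_⟩ <;>
  simp only [localAction_apply, Fin.sum_univ_two, Matrix.diagonal_apply_eq, Matrix.cons_val_zero,
    Matrix.cons_val_one, ne_eq, zero_ne_one, one_ne_zero, not_false_eq_true,
    Matrix.diagonal_apply_ne, zero_mul, mul_zero, add_zero, zero_add, h1, h2, h3, ← exp_add,
    ← add_mul, ← ofReal_add]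
  · rw [← h0]; apply exp_mul_eq_norm; rw [hs]; ring
  · apply exp_mul_eq_norm; rw [hA]; ring
  · apply exp_mul_eq_norm; rw [hA, hB, hC]; ring
  · apply exp_mul_eq_norm; rw [hA, hB, hC]; ring

theorem norm_sq_threeQubit (φ : ThreeQubit) : ‖φ‖ ^ 2 = ∑ i, ∑ j, ∑ k, normSq (φ (i, j, k)) := by
  rw [EuclideanSpace.norm_sq_eq]
  simp only [Fintype.sum_prod_type, normSq_eq_norm_sq]

theorem maxOverlap_pos {ψ : ThreeQubit} (hψ : ‖ψ‖ = 1) : 0 < maxOverlap ψ := by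
  refine lt_of_le_of_ne (maxOverlap_nonneg ψ) fun h => ?_
  have h1 : ∀ i j k, ψ (i, j, k) = 0 := fun i j k => by
    have := normSq_sum_le ψ (Pi.single i 1) (Pi.single j 1) (Pi.single k 1)
    rw [← h] at this
    simp only [Pi.single_apply, ite_mul, one_mul, zero_mul, mul_ite, mul_zero, mul_one,
      Finset.sum_ite_eq', Finset.mem_univ, if_true] at this
    have h2 : normSq (ψ (i, j, k)) ≤ 0 := by simpa using this
    simpa using le_antisymm h2 (normSq_nonneg _)
  have := norm_sq_threeQubit ψ
  simp [h1, hψ] at this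

/-! ### Identification of the extremal vectors with W. -/

/-- The W state in the normal form at one of its closest product vectors. -/
theorem locallyUnitarilyEquivalent_wState {φ : ThreeQubit} {ε : ℝ} (hε : ε ^ 2 = 1)
    (h000 : φ (0, 0, 0) = 2 / 3) (h100 : φ (1, 0, 0) = 0) (h010 : φ (0, 1, 0) = 0)
    (h001 : φ (0, 0, 1) = 0) (h011 : φ (0, 1, 1) = 1 / 3) (h101 : φ (1, 0, 1) = 1 / 3)
    (h110 : φ (1, 1, 0) = 1 / 3) (h111 : φ (1, 1, 1) = -(ε * Real.sqrt 2 / 3 : ℝ) * I) :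
    LocallyUnitarilyEquivalent φ wState := by
  obtain ⟨r, hr⟩ : ∃ r : ℝ, r = 1 / Real.sqrt 3 := ⟨_, rfl⟩
  have hr2 : r ^ 2 = 1 / 3 := by rw [hr, div_pow, Real.sq_sqrt (by norm_num)]; norm_num
  obtain ⟨w, hw⟩ : ∃ w, w = Real.sqrt 2 := ⟨_, rfl⟩
  have hw2 : w ^ 2 = 2 := by rw [hw, Real.sq_sqrt (by norm_num)]
  have cr : (r : ℂ) ^ 2 = 1 / 3 := by rw [← ofReal_pow, hr2]; norm_num
  have cw : (w : ℂ) ^ 2 = 2 := by rw [← ofReal_pow, hw2]; push_cast; rfl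
  have ce : (ε : ℂ) ^ 2 = 1 := by rw [← ofReal_pow, hε]; push_cast; rfl
  have cr4 : (r : ℂ) ^ 4 = 1 / 9 := by linear_combination ((r : ℂ) ^ 2 + 1 / 3) * cr
  rw [← hw] at h111
  -- The first row (√2, 1)/√3 is a factor of a closest product vector of W. The second row is
  -- orthogonal to it, with phase making the amplitudes at 011, 101, 110 positive; the sign `ε`
  -- covers both values of h.
  have hU : (!![(r * w : ℂ), r; -ε * r * I, ε * r * w * I] : Matrix (Fin 2) (Fin 2) ℂ) ∈
      Matrix.unitaryGroup (Fin 2) ℂ := by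
    rw [Matrix.mem_unitaryGroup_iff]
    ext i j
    fin_cases i <;> fin_cases j <;>
      simp [Matrix.mul_apply, Fin.sum_univ_two, Matrix.star_apply]
    · linear_combination (3 : ℂ) * cr + (r : ℂ) ^ 2 * cw
    · ring
    · ring
    · linear_combination (3 : ℂ) * cr + (r : ℂ) ^ 2 * cw + r ^ 2 * (w ^ 2 + 1) * ce -
        (ε ^ 2 * r ^ 2 * (w ^ 2 + 1) : ℂ) * I_sq
  refine ⟨_, hU, _, hU, _, hU, ?_⟩
  have hwS : ∀ i j k, wState (i, j, k) =
      r * ((if (i, j, k) = ((0, 0, 1) : Fin 2 × Fin 2 × Fin 2) then 1 else 0) +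
        (if (i, j, k) = ((0, 1, 0) : Fin 2 × Fin 2 × Fin 2) then 1 else 0) +
        (if (i, j, k) = ((1, 0, 0) : Fin 2 × Fin 2 × Fin 2) then 1 else 0)) := fun i j k => by
    simp [wState, hr, mul_add]
  ext ⟨i, j, k⟩
  rw [localAction_apply]
  simp only [hwS, Fin.sum_univ_two]
  fin_cases i <;> fin_cases j <;> fin_cases k <;>
    simp [h000, h100, h010, h001, h011, h101, h110, h111]
  · linear_combination -(3 * w ^ 2 : ℂ) * cr4 - (1 / 3 : ℂ) * cw
  · linear_combination -(r ^ 4 * ε * w * I : ℂ) * cw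
  · linear_combination -(r ^ 4 * ε * w * I : ℂ) * cw
  · linear_combination -(ε ^ 2 * I ^ 2 * (1 - 2 * w ^ 2) : ℂ) * cr4 -
      (1 / 9 : ℂ) * (I ^ 2 * (1 - 2 * w ^ 2) * ce + (1 - 2 * w ^ 2) * I_sq + 2 * cw)
  · linear_combination -(r ^ 4 * ε * w * I : ℂ) * cw
  · linear_combination -(ε ^ 2 * I ^ 2 * (1 - 2 * w ^ 2) : ℂ) * cr4 -
      (1 / 9 : ℂ) * (I ^ 2 * (1 - 2 * w ^ 2) * ce + (1 - 2 * w ^ 2) * I_sq + 2 * cw)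
  · linear_combination -(ε ^ 2 * I ^ 2 * (1 - 2 * w ^ 2) : ℂ) * cr4 -
      (1 / 9 : ℂ) * (I ^ 2 * (1 - 2 * w ^ 2) * ce + (1 - 2 * w ^ 2) * I_sq + 2 * cw)
  · linear_combination -(3 * ε ^ 3 * I ^ 3 * w : ℂ) * cr4 -
      (1 / 3 * ε * w * I : ℂ) * (I ^ 2 * ce + I_sq)

theorem normal_form_eq_wState_of_maxOverlap_sq_le {φ : ThreeQubit} {a b c : ℝ} (hφ : ‖φ‖ = 1)
    (ha : 0 ≤ a) (hb : 0 ≤ b) (hc : 0 ≤ c)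
    (h000 : φ (0, 0, 0) = maxOverlap φ) (h100 : φ (1, 0, 0) = 0) (h010 : φ (0, 1, 0) = 0)
    (h001 : φ (0, 0, 1) = 0) (h011 : φ (0, 1, 1) = a) (h101 : φ (1, 0, 1) = b)
    (h110 : φ (1, 1, 0) = c) (hG : maxOverlap φ ^ 2 ≤ 4 / 9) :
    maxOverlap φ = 2 / 3 ∧ LocallyUnitarilyEquivalent φ wState := by
  obtain ⟨g, hg⟩ : ∃ g, g = maxOverlap φ := ⟨_, rfl⟩
  have hg0 : 0 < g := hg ▸ maxOverlap_pos hφ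
  have hgc : (g : ℂ) ≠ 0 := by exact_mod_cast hg0.ne'
  have hle := normSq_sum_le φ
  rw [← hg] at h000 hG hle ⊢
  obtain ⟨h, hh⟩ : ∃ h, h = φ (1, 1, 1) := ⟨_, rfl⟩
  obtain ⟨hK, hN, h0, h1⟩ := real_conditions_of_overlap_le (a / g) (b / g) (c / g) (h / g)
    fun x y₀ y₁ z₀ z₁ => by
      have h2 := hle ![1, x] ![y₀, y₁] ![z₀, z₁]
      simp only [Fin.sum_univ_two, Matrix.cons_val_zero, Matrix.cons_val_one, h000, h100, h010,
        h001, h011, h101, h110, ← hh, map_one] at h2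
      have e : y₀ * z₀ + ((a / g : ℝ) : ℂ) * y₁ * z₁ + ((b / g : ℝ) : ℂ) * x * y₀ * z₁ +
          ((c / g : ℝ) : ℂ) * x * y₁ * z₀ + h / g * x * y₁ * z₁ =
          ((g⁻¹ : ℝ) : ℂ) * (1 * y₀ * z₀ * g + 1 * y₀ * z₁ * 0 + (1 * y₁ * z₀ * 0 +
          1 * y₁ * z₁ * a) + (x * y₀ * z₀ * 0 + x * y₀ * z₁ * b +
          (x * y₁ * z₀ * c + x * y₁ * z₁ * h))) := by
        push_cast
        field_simp
        ring
      rw [e, map_mul, normSq_ofReal]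
      have h3 := mul_le_mul_of_nonneg_left h2 (mul_self_nonneg g⁻¹)
      refine h3.trans_eq ?_
      field_simp
  have hnorm : g ^ 2 + a ^ 2 + b ^ 2 + c ^ 2 + normSq h = 1 := by
    have h2 := norm_sq_threeQubit φ
    simp only [Fin.sum_univ_two, h000, h100, h010, h001, h011, h101, h110, ← hh, hφ,
      normSq_ofReal, map_zero] at h2
    linarith
  have hsum : (a / g) ^ 2 + (b / g) ^ 2 + (c / g) ^ 2 + ((h / g).re ^ 2 + (h / g).im ^ 2) =
      1 / g ^ 2 - 1 := by
    have e : (h / g).re ^ 2 + (h / g).im ^ 2 = normSq h / g ^ 2 := by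
      rw [pow_two g, ← normSq_ofReal, ← map_div₀, normSq_apply]; ring
    rw [e]
    field_simp
    linarith
  have hS : 5 / 4 ≤ (a / g) ^ 2 + (b / g) ^ 2 + (c / g) ^ 2 +
      ((h / g).re ^ 2 + (h / g).im ^ 2) := by
    rw [hsum]
    have : 9 / 4 ≤ 1 / g ^ 2 := by
      rw [le_div_iff₀ (by positivity)]; linarith
    linarith
  obtain ⟨ea, eb, ec, eu, ev⟩ := eq_half_of_five_quarters_le _ _ _ _ _ (div_nonneg ha hg0.le)
    (div_nonneg hb hg0.le) (div_nonneg hc hg0.le) hK hN h0 h1 hS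
  rw [ea, eb, ec, eu, ev] at hsum
  have hg2 : g = 2 / 3 := by
    have h2 : 1 / g ^ 2 = 9 / 4 := by linarith
    have h3 : g ^ 2 = (2 / 3) ^ 2 := by
      field_simp at h2
      linarith
    exact (pow_left_inj₀ hg0.le (by norm_num) two_ne_zero).1 h3
  refine ⟨hg2, ?_⟩
  have eh : h = (h / g).re * g + (h / g).im * g * I := by
    have := re_add_im (h / g)
    have e : h = h / g * g := by field_simp
    nth_rw 1 [e, ← this]
    ring
  rw [hg2, div_eq_iff (by norm_num)] at ea eb ec
  have hs2 : Real.sqrt 2 ^ 2 = 2 := Real.sq_sqrt (by norm_num)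
  refine locallyUnitarilyEquivalent_wState (ε := -(h / g).im * Real.sqrt 2) ?_ ?_ h100 h010 h001
    ?_ ?_ ?_ ?_
  · rw [mul_pow, hs2, neg_sq, ev]; norm_num
  · rw [h000, hg2]; push_cast; rfl
  · rw [h011, ea]; push_cast; norm_num
  · rw [h101, eb]; push_cast; norm_num
  · rw [h110, ec]; push_cast; norm_num
  · rw [← hh]
    nth_rw 1 [eh]
    rw [eu, hg2]
    have cs : (Real.sqrt 2 : ℂ) ^ 2 = 2 := by rw [← ofReal_pow, hs2]; norm_num
    push_cast
    linear_combination (-(((h / (2 / 3)).im : ℂ) * I / 3)) * cs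

theorem eq_two_thirds_and_equiv_wState_of_maxOverlap_sq_le {ψ : ThreeQubit} (hψ : ‖ψ‖ = 1) (hG : maxOverlap ψ ^ 2 ≤ 4 / 9) :
    maxOverlap ψ = 2 / 3 ∧ LocallyUnitarilyEquivalent ψ wState := by
  obtain ⟨φ, a, b, c, hLU, ha, hb, hc, h000, h100, h010, h001, h011, h101, h110⟩ :=
    exists_normal_form ψ
  rw [← hLU.maxOverlap_eq] at h000 hG ⊢
  obtain ⟨h1, h2⟩ := normal_form_eq_wState_of_maxOverlap_sq_le (hLU.norm_eq.trans hψ) ha hb hc h000 h100 h010 h001 h011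
    h101 h110 hG
  exact ⟨h1, hLU.symm.trans h2⟩

/-! ### The overlap of W and the conclusion. -/

theorem wState_apply (i j k : Fin 2) :
    wState (i, j, k) = ((1 / Real.sqrt 3 : ℝ) : ℂ) * if (i : ℕ) + j + k = 1 then 1 else 0 := by
  fin_cases i <;> fin_cases j <;> fin_cases k <;> simp [wState]

theorem norm_wState : ‖wState‖ = 1 := by
  have h := norm_sq_threeQubit wState
  simp [wState_apply, Fin.sum_univ_two] at h
  have h2 : ‖wState‖ ^ 2 = 1 ^ 2 := by rw [h]; norm_num
  exact (pow_left_inj₀ (norm_nonneg _) (by norm_num) two_ne_zero).1 h2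

/-- Cauchy–Schwarz removes (p, q). For angles α, β of the other two vectors, m = cos(α - β) and n =
cos(α + β) leave 1 + m²/3 - (3n - m)²/12 ≤ 4/3. -/
theorem real_wState_bound {x y u v p q : ℝ} (hxy : x ^ 2 + y ^ 2 = 1) (huv : u ^ 2 + v ^ 2 = 1)
    (hpq : p ^ 2 + q ^ 2 = 1) :
    (x * u * q + x * v * p + y * u * p) ^ 2 ≤ 4 / 3 := by
  have h1 : (x * u * q + x * v * p + y * u * p) ^ 2 ≤ (x * u) ^ 2 + (x * v + y * u) ^ 2 := by
    have e : (x * u) ^ 2 + (x * v + y * u) ^ 2 =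
        ((x * u) ^ 2 + (x * v + y * u) ^ 2) * (p ^ 2 + q ^ 2) := by rw [hpq, mul_one]
    rw [e]
    linarith [sq_nonneg (x * u * p - (x * v + y * u) * q)]
  have h2 : (x * u - y * v) ^ 2 + (x * v + y * u) ^ 2 = 1 := by
    linear_combination (u ^ 2 + v ^ 2) * hxy + huv
  have h3 : (x * u + y * v) ^ 2 ≤ 1 := by
    have : (x * u + y * v) ^ 2 + (x * v - y * u) ^ 2 = 1 := by
      linear_combination (u ^ 2 + v ^ 2) * hxy + huv
    linarith [sq_nonneg (x * v - y * u)]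
  obtain ⟨m, hm⟩ : ∃ m, m = x * u + y * v := ⟨_, rfl⟩
  obtain ⟨n, hn⟩ : ∃ n, n = x * u - y * v := ⟨_, rfl⟩
  have e : (x * u) ^ 2 = ((m + n) / 2) ^ 2 := by rw [hm, hn]; ring
  rw [← hn] at h2
  rw [← hm] at h3
  rw [e] at h1
  linarith [sq_nonneg (3 * n - m)]

theorem maxOverlap_wState_le : maxOverlap wState ^ 2 ≤ 4 / 9 := by
  obtain ⟨a, b, c, ha, hb, hc, h⟩ := (isGreatest_maxOverlap wState).1
  have hn : ∀ a : Qubit, ‖a‖ = 1 → ‖a 0‖ ^ 2 + ‖a 1‖ ^ 2 = 1 := fun a ha => by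
    rw [← Fin.sum_univ_two (fun i => ‖a i‖ ^ 2), ← EuclideanSpace.norm_sq_eq, ha, one_pow]
  have hb3 := real_wState_bound (hn a ha) (hn b hb) (hn c hc)
  have e : inner ℂ (productVector a b c) wState = ((1 / Real.sqrt 3 : ℝ) : ℂ) *
      (conj (a 0) * conj (b 0) * conj (c 1) + conj (a 0) * conj (b 1) * conj (c 0) +
        conj (a 1) * conj (b 0) * conj (c 0)) := by
    rw [inner_productVector]
    simp [wState_apply, Fin.sum_univ_two]
    ring
  have h1 : ‖conj (a 0) * conj (b 0) * conj (c 1) + conj (a 0) * conj (b 1) * conj (c 0) +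
      conj (a 1) * conj (b 0) * conj (c 0)‖ ≤
      ‖a 0‖ * ‖b 0‖ * ‖c 1‖ + ‖a 0‖ * ‖b 1‖ * ‖c 0‖ + ‖a 1‖ * ‖b 0‖ * ‖c 0‖ := by
    refine norm_add₃_le.trans_eq ?_
    simp only [norm_mul, RCLike.norm_conj]
  have h2 := pow_le_pow_left₀ (norm_nonneg _) h1 2
  have h3 : (1 / Real.sqrt 3) ^ 2 = 1 / 3 := by
    rw [div_pow, Real.sq_sqrt (by norm_num)]; norm_num
  rw [h, e, norm_mul, mul_pow, norm_real, Real.norm_eq_abs, sq_abs, h3]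
  linarith

/-- Only the upper bound is computed; the rigidity statement turns it into equality, so no optimal
product vector need be exhibited. -/
theorem maxOverlap_wState : maxOverlap wState = 2 / 3 :=
  (eq_two_thirds_and_equiv_wState_of_maxOverlap_sq_le norm_wState maxOverlap_wState_le).1

theorem le_maxOverlap_sq {ψ : ThreeQubit} (hψ : ‖ψ‖ = 1) : 4 / 9 ≤ maxOverlap ψ ^ 2 := by
  by_contra! h
  have := (eq_two_thirds_and_equiv_wState_of_maxOverlap_sq_le hψ h.le).1
  rw [this] at h
  norm_num at h

theorem theorem1 :
    IsMaximallyEntangled wState ∧ maxOverlap wState ^ 2 = 4 / 9 ∧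
      ∀ ψ : ThreeQubit,
        IsMaximallyEntangled ψ ↔ LocallyUnitarilyEquivalent ψ wState := by
  have hW : maxOverlap wState ^ 2 = 4 / 9 := by rw [maxOverlap_wState]; norm_num
  refine ⟨⟨norm_wState, fun φ hφ => ?_⟩, hW, fun ψ => ⟨fun h => ?_, fun h => ⟨?_, fun φ hφ => ?_⟩⟩⟩
  · rw [geometricMeasure, geometricMeasure, hW]
    linarith [le_maxOverlap_sq hφ]
  · have h1 := h.2 wState norm_wState
    rw [geometricMeasure, geometricMeasure, hW] at h1
    exact (eq_two_thirds_and_equiv_wState_of_maxOverlap_sq_le h.1 (by linarith)).2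
  · rw [h.norm_eq, norm_wState]
  · rw [geometricMeasure, geometricMeasure, h.maxOverlap_eq, hW]
    linarith [le_maxOverlap_sq hφ]
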